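/- Let $d,N\ge 1$, let $f_1,\dots,f_N:\mathbb{R}^d\to\mathbb{R}^d$ satisfy $$s_i\|x-y\|\le\|f_i(x)-f_i(y)\|\le c_i\|x-y\|\qquad(x,y\in\mathbb{R}^d,\ 1\le i\le N)$$ with constants $0<s_i\le c_i<1$ (Euclidean norm), and let $(p_1,\dots,p_N)$ be a probability vector with all $p_i>0$. Let $E$ be the attractor of the system, i.e. the unique nonempty compact set with $E=\bigcup_{i=1}^N f_i(E)$, and let $\mu$ be its invariant measure, i.e. the unique Borel probability measure supported on $E$ with $\mu=\sum_{i=1}^N p_i\,\mu\circ f_i^{-1}$. Assume the strong open set condition: there is an open set $O\subset\mathbb{R}^d$ with $O\cap E\neq\emptyset$, $f_i(O)\subset O$ for all $i$, and $f_i(O)\cap f_j(O)=\emptyset$ for $i\ne j$. For $r\in(0,\infty)$ and $n\in\mathbb{N}$ put $$V_{n,r}(\mu)=\inf\Big\{\int \operatorname{dist}(x,A)^r\,d\mu(x): A\subset\mathbb{R}^d,\ \operatorname{Card}(A)\le n\Big\},\quad e_{n,r}(\mu)=V_{n,r}(\mu)^{1/r},\quad \underline{D}_r(\mu)=\liminf_{n\to\infty}\frac{\log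 n}{-\log e_{n,r}(\mu)}$$ (the quotient is $0$ if $e_{n,r}(\mu)=0$). Then for every $r\in(0,\infty)$ there is a unique $k_r\in[0,\infty)$ with $$\sum_{i=1}^N (p_i s_i^r)^{\frac{k_r}{r+k_r}}=1$$ (and $k_r>0$ if $N\ge2$), and $\underline{D}_r(\mu)\ge k_r$. -/

import Mathlib

open MeasureTheory Filter
open scoped ENNReal

noncomputable section

/-- `E` is the attractor of the maps `f 0, …, f (N-1)`: a nonempty compact set with
`E = ⋃ i, f i (E)`.  (For contractions of a complete metric space there is exactly one such set.) -/
structure IsAttractor {X : Type*} [MetricSpace X] {N : ℕ} (f : Fin N → X → X) (E : Set X) :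
    Prop where
  nonempty : E.Nonempty
  isCompact : IsCompact E
  eq_iUnion : E = ⋃ i, f i '' E

/-- The strong open set condition for the system `f` with attractor `E`: there is an open set `O`
that meets `E` (hence is nonempty), with `f i (O) ⊆ O` for all `i` and with
`f i (O) ∩ f j (O) = ∅` for `i ≠ j`. -/
def StrongOpenSetCondition {X : Type*} [MetricSpace X] {N : ℕ} (f : Fin N → X → X) (E : Set X) :
    Prop :=
  ∃ O : Set X, IsOpen O ∧ (O ∩ E).Nonempty ∧ (∀ i, f i '' O ⊆ O) ∧
    ∀ i j, i ≠ j → Disjoint (f i '' O) (f j '' O)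

/-- `μ` is the invariant measure of the system `f` with weights `p` and attractor `E`: a Borel
probability measure supported on `E` with `μ = ∑ i, p i • (μ ∘ (f i)⁻¹)`. -/
structure IsInvariantMeasure {X : Type*} [MetricSpace X] [MeasurableSpace X] [BorelSpace X]
    {N : ℕ} (f : Fin N → X → X) (p : Fin N → ℝ) (E : Set X) (μ : Measure X) : Prop where
  isProbabilityMeasure : IsProbabilityMeasure μ
  measure_compl : μ Eᶜ = 0
  eq_sum : μ = ∑ i, ENNReal.ofReal (p i) • μ.map (f i)

/-- The `n`-th quantization error `V_{n,r}(μ)` of order `r`: the infimum of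
`∫ dist(x, A)^r dμ(x)` over the sets `A` with at most `n` points. The distance to the empty set
is `∞`, so that for a probability measure the empty set plays no role when `n ≥ 1`. -/
def quantizationError {X : Type*} [MetricSpace X] [MeasurableSpace X]
    (μ : Measure X) (n : ℕ) (r : ℝ) : ℝ≥0∞ :=
  ⨅ (A : Finset X) (_ : A.card ≤ n), ∫⁻ x, Metric.infEDist x (A : Set X) ^ r ∂μ

/-- The lower quantization dimension of order `r`,
`liminf (log n / (- log e_{n,r}(μ)))` with `e_{n,r}(μ) = V_{n,r}(μ)^(1/r)`, as an extended real.
The logarithm is extended-real-valued: `log 0 = -∞`, so the quotient is `0` if `e_{n,r}(μ) = 0`. -/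
def lowerQuantizationDim {X : Type*} [MetricSpace X] [MeasurableSpace X]
    (μ : Measure X) (r : ℝ) : EReal :=
  liminf (fun n : ℕ => ENNReal.log (n : ℝ≥0∞) /
    (-ENNReal.log (quantizationError μ n r ^ (1 / r)))) atTop

end

/-!
Fix `0 < t < k`, where `k` solves `∑ i, (p i * s i ^ r) ^ (k / (r + k)) = 1`, and put
`θ = t / (r + t)`. Since all bases are smaller than `1`, the sum `ρ = ∑ i, (p i * s i ^ r) ^ θ`
exceeds `1`, and the corresponding sum over all words of length `m` is `ρ ^ m`.

By the strong open set condition some composition `h` of the maps satisfies `h '' E ⊆ O`. For the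
words `g a` of length `m` the compact sets `(g a ∘ h) '' E` are then pairwise disjoint, hence
uniformly separated, and `μ` dominates `∑ a, q a • μ.map (g a ∘ h)`. Passing from words to words
followed by `h` costs a factor independent of `m`, which `ρ ^ m` absorbs for large `m`.

For a strongly separated family with `∑ a, β a ^ θ ≥ 1`, where `β a = q a * (S a / 2) ^ r`, the
error with distances truncated at the separation constant `δ` is at least `C * n ^ (-(r / t))`
for `n`-point sets (`exists_le_truncatedError`). This goes by strong induction on `n`: each point
of `A` is close to at most one piece, so `A` splits into parts `A a`, each of which is pulled back
along its map. Either some part is empty, and then the error is bounded below by a constant, or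
all parts are smaller than `A`, and Hölder's inequality (`rpow_le_sum_mul_rpow`) closes the
induction. The maps need not be onto, so a point of `A a` is first moved to a nearest point of the
piece; this at most doubles distances, which explains the factor `1 / 2` in `β a`. Like the cost
of `h`, this factor does not depend on `m`.

Hence the quantization error is at least `C * n ^ (-(r / t))` for every `t < k`, which gives the
bound on the lower quantization dimension.
-/

open MeasureTheory Filter Metric
open scoped ENNReal

/-! ### Inequalities for real powers -/

/-- Hölder's inequality in the form needed for distributing points among the pieces: if
`∑ a, β a ^ (t / (r + t)) ≥ 1`, the minimum of `∑ a, β a * x a ^ (-(r / t))` subject to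
`∑ a, x a ≤ n` is at least `n ^ (-(r / t))`. -/
theorem rpow_le_sum_mul_rpow {ι : Type*} [Fintype ι] {r t : ℝ} (hr : 0 < r) (ht : 0 < t)
    (β x : ι → ℝ) (hβ : ∀ a, 0 < β a) (hx : ∀ a, 0 < x a)
    (hsum : 1 ≤ ∑ a, β a ^ (t / (r + t))) {n : ℝ} (hn : 0 < n) (hxn : ∑ a, x a ≤ n) :
    n ^ (-(r / t)) ≤ ∑ a, β a * x a ^ (-(r / t)) := by
  have hrt : 0 < r + t := by positivity
  have hconj : Real.HolderConjugate ((r + t) / t) ((r + t) / r) := by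
    rw [Real.holderConjugate_iff]
    constructor
    · rw [one_lt_div ht]; linarith
    · field_simp; ring
  have key := Real.inner_le_Lp_mul_Lq_of_nonneg Finset.univ hconj
    (f := fun a => (β a * x a ^ (-(r / t))) ^ (t / (r + t)))
    (g := fun a => x a ^ (r / (r + t)))
    (fun a _ => by have := hβ a; have := hx a; positivity)
    (fun a _ => by have := hx a; positivity)
  have e1 : ∀ a, (β a * x a ^ (-(r / t))) ^ (t / (r + t)) * x a ^ (r / (r + t))
      = β a ^ (t / (r + t)) := fun a => by
    rw [Real.mul_rpow (hβ a).le (Real.rpow_nonneg (hx a).le _), ← Real.rpow_mul (hx a).le,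
      mul_assoc, ← Real.rpow_add (hx a)]
    have : -(r / t) * (t / (r + t)) + r / (r + t) = 0 := by field_simp; ring
    rw [this, Real.rpow_zero, mul_one]
  have e2 : ∀ a, ((β a * x a ^ (-(r / t))) ^ (t / (r + t))) ^ ((r + t) / t)
      = β a * x a ^ (-(r / t)) := fun a => by
    rw [← Real.rpow_mul (mul_nonneg (hβ a).le (Real.rpow_nonneg (hx a).le _))]
    have : t / (r + t) * ((r + t) / t) = 1 := by field_simp
    rw [this, Real.rpow_one]
  have e3 : ∀ a, (x a ^ (r / (r + t))) ^ ((r + t) / r) = x a := fun a => by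
    rw [← Real.rpow_mul (hx a).le]
    have : r / (r + t) * ((r + t) / r) = 1 := by field_simp
    rw [this, Real.rpow_one]
  simp only [e1, e2, e3] at key
  set T := ∑ a, β a * x a ^ (-(r / t)) with hT
  have hT0 : 0 ≤ T := Finset.sum_nonneg fun a _ =>
    mul_nonneg (hβ a).le (Real.rpow_nonneg (hx a).le _)
  have hx0 : 0 ≤ ∑ a, x a := Finset.sum_nonneg fun a _ => (hx a).le
  have h1 : 1 ≤ T ^ (t / (r + t)) * n ^ (r / (r + t)) := by
    calc (1 : ℝ) ≤ _ := hsum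
      _ ≤ _ := key
      _ ≤ T ^ (1 / ((r + t) / t)) * n ^ (1 / ((r + t) / r)) := by gcongr
      _ = _ := by rw [one_div_div, one_div_div]
  have h2 : 1 ≤ (T ^ (t / (r + t)) * n ^ (r / (r + t))) ^ ((r + t) / t) :=
    Real.one_le_rpow h1 (by positivity)
  rw [Real.mul_rpow (Real.rpow_nonneg hT0 _) (Real.rpow_nonneg hn.le _), ← Real.rpow_mul hT0,
    ← Real.rpow_mul hn.le] at h2
  have e4 : t / (r + t) * ((r + t) / t) = 1 := by field_simp
  have e5 : r / (r + t) * ((r + t) / t) = r / t := by field_simp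
  rw [e4, e5, Real.rpow_one] at h2
  rw [Real.rpow_neg hn.le, inv_le_iff_one_le_mul₀ (by positivity)]
  exact h2

theorem natCast_rpow_neg_le_one (n : ℕ) {u : ℝ} (hu : 0 < u) : (n : ℝ) ^ (-u) ≤ 1 := by
  rcases Nat.eq_zero_or_pos n with rfl | hn
  · rw [Nat.cast_zero, Real.zero_rpow (by linarith)]
    exact zero_le_one
  · exact Real.rpow_le_one_of_one_le_of_nonpos (by exact_mod_cast hn) (by linarith)

theorem sum_rpow_strictAnti {ι : Type*} [Fintype ι] [Nonempty ι] (b : ι → ℝ)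
    (hb0 : ∀ i, 0 < b i) (hb1 : ∀ i, b i < 1) : StrictAnti fun u : ℝ => ∑ i, b i ^ u :=
  fun _ _ huv => Finset.sum_lt_sum_of_nonempty Finset.univ_nonempty fun i _ =>
    Real.rpow_lt_rpow_of_exponent_gt (hb0 i) (hb1 i) huv

theorem div_add_lt_div_add {r t k : ℝ} (hr : 0 < r) (ht : 0 ≤ t) (h : t < k) :
    t / (r + t) < k / (r + k) := by
  rw [div_lt_div_iff₀ (by linarith) (by linarith)]
  nlinarith

/-- The substitution `u = k / (r + k)` maps `[0, ∞)` bijectively onto `[0, 1)`, and the sum is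
strictly decreasing in `u`, at least `1` at `u = 0` and less than `1` at `u = 1`. -/
theorem existsUnique_sum_rpow_eq_one {ι : Type*} [Fintype ι] [Nonempty ι] (b : ι → ℝ)
    (hb0 : ∀ i, 0 < b i) (hb1 : ∀ i, b i < 1) (hsum : ∑ i, b i < 1) {r : ℝ} (hr : 0 < r) :
    ∃! k : ℝ, 0 ≤ k ∧ ∑ i, b i ^ (k / (r + k)) = 1 := by
  have hanti := sum_rpow_strictAnti b hb0 hb1
  have hcont : Continuous fun u : ℝ => ∑ i, b i ^ u :=
    continuous_finsetSum _ fun i _ => Real.continuous_const_rpow (hb0 i).ne'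
  have hmem : (1 : ℝ) ∈ Set.Icc (∑ i, b i ^ (1 : ℝ)) (∑ i, b i ^ (0 : ℝ)) := by
    refine ⟨by simpa using hsum.le, ?_⟩
    simp only [Real.rpow_zero, Finset.sum_const, nsmul_eq_mul, mul_one]
    exact_mod_cast Finset.card_pos.mpr Finset.univ_nonempty
  obtain ⟨u, ⟨hu0, hu1⟩, hu⟩ :=
    intermediate_value_Icc' (zero_le_one' ℝ) hcont.continuousOn hmem
  have hu1' : u < 1 := by
    rcases hu1.lt_or_eq with h | rfl
    · exact h
    · simp only [Real.rpow_one] at hu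
      linarith
  have h1u : 0 < 1 - u := by linarith
  refine ⟨r * u / (1 - u), ⟨by positivity, ?_⟩, ?_⟩
  · have : r * u / (1 - u) / (r + r * u / (1 - u)) = u := by
      have : r + r * u / (1 - u) = r / (1 - u) := by field_simp; ring
      rw [this]
      field_simp
    rw [this]
    exact hu
  · rintro k ⟨hk, hk1⟩
    have : k / (r + k) = u := hanti.injective (hk1.trans hu.symm)
    have hrk : r + k ≠ 0 := by positivity
    rw [eq_div_iff h1u.ne', ← this]
    field_simp
    ring

/-! ### Quantization error of strongly separated families -/

section Separated

variable {X : Type*} [MetricSpace X]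

/-- The error at `x` of approximation by the points of `A`, with distances truncated at `δ`. -/
noncomputable def truncatedError (δ r : ℝ) (A : Finset X) (x : X) : ℝ≥0∞ :=
  min (infEDist x (A : Set X)) (ENNReal.ofReal δ) ^ r

theorem measurable_truncatedError [MeasurableSpace X] [BorelSpace X] (δ r : ℝ) (A : Finset X) :
    Measurable (truncatedError δ r A) :=
  ((continuous_infEDist.measurable).min measurable_const).pow_const r

/-- Pullback of the points of `A` near the piece `G '' E` along `G`: each of them is replaced by
a nearest point of the piece, at the cost of a factor `2` in the distance. The points of `A`
far from the piece are irrelevant for the truncated error on it. -/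
theorem exists_pullback_truncatedError [DecidableEq X] {E : Set X} (hE : IsCompact E)
    (hne : E.Nonempty) {G : X → X} (hG : Continuous G) {S : ℝ} (hS : 0 < S) (hS1 : S ≤ 1)
    (hlow : ∀ x y, S * dist x y ≤ dist (G x) (G y)) {δ r : ℝ} (hr : 0 < r)
    (A B : Finset X) (hB : ∀ y ∈ A, y ∈ thickening δ (G '' E) → y ∈ B) :
    ∃ A' : Finset X, A'.card ≤ B.card ∧ ∀ x ∈ E,
      ENNReal.ofReal ((S / 2) ^ r) * truncatedError δ r A' x ≤ truncatedError δ r A (G x) := by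
  have hz : ∀ y, ∃ z ∈ E, ∀ x ∈ E, dist (G z) y ≤ dist (G x) y := fun y => by
    obtain ⟨z, hzE, hz⟩ := hE.exists_isMinOn hne
      (f := fun x => dist (G x) y) (by fun_prop)
    exact ⟨z, hzE, fun x hx => hz hx⟩
  choose z hzE hz using hz
  refine ⟨B.image z, Finset.card_image_le, fun x hx => ?_⟩
  have hS2 : 0 ≤ S / 2 := by positivity
  unfold truncatedError
  rw [← ENNReal.ofReal_rpow_of_nonneg hS2 hr.le, ← ENNReal.mul_rpow_of_nonneg _ _ hr.le]
  refine ENNReal.rpow_le_rpow ?_ hr.le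
  have htrunc : ENNReal.ofReal (S / 2) * min (infEDist x (B.image z : Finset X))
      (ENNReal.ofReal δ) ≤ ENNReal.ofReal δ :=
    calc _ ≤ 1 * ENNReal.ofReal δ := by
          gcongr
          · rw [ENNReal.ofReal_le_one]; linarith
          · exact min_le_right _ _
      _ = _ := one_mul _
  refine le_min (le_infEDist.mpr fun y hy => ?_) htrunc
  by_cases hyB : y ∈ thickening δ (G '' E)
  · have hmem : z y ∈ (B.image z : Finset X) :=
      Finset.mem_image_of_mem _ (hB y hy hyB)
    calc _ ≤ ENNReal.ofReal (S / 2) * edist x (z y) := by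
          gcongr
          exact (min_le_left _ _).trans (infEDist_le_edist_of_mem (by exact_mod_cast hmem))
      _ = ENNReal.ofReal (S / 2 * dist x (z y)) := by
          rw [edist_dist, ← ENNReal.ofReal_mul hS2]
      _ ≤ edist (G x) y := by
          rw [edist_dist]
          refine ENNReal.ofReal_le_ofReal ?_
          have h1 := hlow x (z y)
          have h2 := dist_triangle_right (G x) (G (z y)) y
          have h3 := hz y x hx
          linarith
  · refine htrunc.trans ?_
    rw [mem_thickening_iff_infEDist_lt, not_lt] at hyB
    rw [edist_comm]
    exact hyB.trans (infEDist_le_edist_of_mem (Set.mem_image_of_mem G hx))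

theorem exists_pos_disjoint_thickening {ι : Type*} [Finite ι] [Nonempty ι] (K : ι → Set X)
    (hK : ∀ a, IsCompact (K a)) (hd : ∀ a b, a ≠ b → Disjoint (K a) (K b)) :
    ∃ δ : ℝ, 0 < δ ∧ ∀ a b, a ≠ b → Disjoint (thickening δ (K a)) (thickening δ (K b)) := by
  have h : ∀ q : ι × ι, ∃ δ : ℝ, 0 < δ ∧
      (q.1 ≠ q.2 → Disjoint (thickening δ (K q.1)) (thickening δ (K q.2))) := fun q => by
    by_cases hq : q.1 = q.2
    · exact ⟨1, one_pos, fun h => absurd hq h⟩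
    · obtain ⟨δ, hδ, h⟩ := (hd _ _ hq).exists_thickenings (hK q.1) (hK q.2).isClosed
      exact ⟨δ, hδ, fun _ => h⟩
  choose δ hδ h using h
  obtain ⟨q, hq⟩ := Finite.exists_min δ
  exact ⟨δ q, hδ q, fun a b hab => (h (a, b) hab).mono
    (thickening_mono (hq _) _) (thickening_mono (hq _) _)⟩

variable [MeasurableSpace X] [BorelSpace X]

/-- Lower bound for the truncated quantization error of a measure that dominates the weighted sum
of its images under a strongly separated family. -/
theorem exists_le_truncatedError {ι : Type*} [Fintype ι] [Nontrivial ι] {E : Set X}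
    (hE : IsCompact E) (hne : E.Nonempty) (μ : Measure X) [IsProbabilityMeasure μ]
    (hμE : μ Eᶜ = 0) (G : ι → X → X) (q S : ι → ℝ) (hG : ∀ a, Continuous (G a))
    (hq : ∀ a, 0 < q a) (hS : ∀ a, 0 < S a) (hS1 : ∀ a, S a ≤ 1)
    (hlow : ∀ a x y, S a * dist x y ≤ dist (G a x) (G a y))
    (hdisj : ∀ a b, a ≠ b → Disjoint (G a '' E) (G b '' E))
    (hsub : ∀ F : X → ℝ≥0∞, Measurable F →
      ∑ a, ENNReal.ofReal (q a) * ∫⁻ x, F (G a x) ∂μ ≤ ∫⁻ x, F x ∂μ)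
    {r t : ℝ} (hr : 0 < r) (ht : 0 < t)
    (hsum : 1 ≤ ∑ a, (q a * (S a / 2) ^ r) ^ (t / (r + t))) :
    ∃ δ C : ℝ, 0 < C ∧ ∀ A : Finset X,
      ENNReal.ofReal (C * (A.card : ℝ) ^ (-(r / t))) ≤ ∫⁻ x, truncatedError δ r A x ∂μ := by
  classical
  set β : ι → ℝ := fun a => q a * (S a / 2) ^ r with hβ_def
  have hβ : ∀ a, 0 < β a := fun a => by
    have := hq a; have := hS a; positivity
  obtain ⟨δ, hδ, hsep⟩ := exists_pos_disjoint_thickening (fun a => G a '' E)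
    (fun a => hE.image (hG a)) hdisj
  obtain ⟨a₀, ha₀⟩ := Finite.exists_min β
  -- `β a₀ * δ ^ r` bounds the error from below as soon as one piece has no points of `A` nearby.
  refine ⟨δ, β a₀ * δ ^ r, by have := hβ a₀; positivity, fun A => ?_⟩
  set C := β a₀ * δ ^ r with hC
  have hC0 : 0 < C := by have := hβ a₀; positivity
  have hrt : 0 < r / t := by positivity
  induction hn : A.card using Nat.strong_induction_on generalizing A with
  | _ n ih =>
  set B : ι → Finset X := fun a => A.filter fun y => y ∈ thickening δ (G a '' E) with hB
  have hpull : ∀ a, ∃ A' : Finset X, A'.card ≤ (B a).card ∧ ∀ x ∈ E,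
      ENNReal.ofReal ((S a / 2) ^ r) * truncatedError δ r A' x ≤
        truncatedError δ r A (G a x) := fun a =>
    exists_pullback_truncatedError hE hne (hG a) (hS a) (hS1 a) (hlow a) hr A (B a)
      fun y hy hy' => Finset.mem_filter.mpr ⟨hy, hy'⟩
  choose A' hcard hle using hpull
  have hae : ∀ᵐ x ∂μ, x ∈ E := by
    rw [ae_iff]
    exact hμE
  have hmain : ∑ a, ENNReal.ofReal (β a) * ∫⁻ x, truncatedError δ r (A' a) x ∂μ ≤
      ∫⁻ x, truncatedError δ r A x ∂μ := by
    refine le_trans (Finset.sum_le_sum fun a _ => ?_) (hsub _ (measurable_truncatedError δ r A))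
    rw [hβ_def, ENNReal.ofReal_mul (hq a).le, mul_assoc,
      ← lintegral_const_mul _ (measurable_truncatedError δ r (A' a))]
    gcongr 1
    refine lintegral_mono_ae ?_
    filter_upwards [hae] with x hx using hle a x hx
  refine le_trans ?_ hmain
  by_cases hempty : ∃ a, (A' a).card = 0
  · obtain ⟨a, ha⟩ := hempty
    have hA' : A' a = ∅ := Finset.card_eq_zero.mp ha
    have hval : ∫⁻ x, truncatedError δ r (A' a) x ∂μ = ENNReal.ofReal (δ ^ r) := by
      simp [hA', truncatedError, ENNReal.ofReal_rpow_of_pos hδ]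
    calc ENNReal.ofReal (C * (n : ℝ) ^ (-(r / t)))
        ≤ ENNReal.ofReal (β a * δ ^ r) := by
          refine ENNReal.ofReal_le_ofReal ?_
          calc C * (n : ℝ) ^ (-(r / t)) ≤ C * 1 := by
                gcongr
                exact natCast_rpow_neg_le_one n hrt
            _ ≤ β a * δ ^ r := by
                rw [mul_one, hC]
                gcongr
                exact ha₀ a
      _ = ENNReal.ofReal (β a) * ∫⁻ x, truncatedError δ r (A' a) x ∂μ := by
          rw [hval, ENNReal.ofReal_mul (hβ a).le]
      _ ≤ _ := Finset.single_le_sum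
          (f := fun a => ENNReal.ofReal (β a) * ∫⁻ x, truncatedError δ r (A' a) x ∂μ)
          (fun _ _ => zero_le) (Finset.mem_univ a)
  · push Not at hempty
    have hBdisj : ∀ a b, a ≠ b → Disjoint (B a) (B b) := fun a b hab => by
      rw [Finset.disjoint_left]
      intro y hya hyb
      exact Set.disjoint_left.mp (hsep a b hab) (Finset.mem_filter.mp hya).2
        (Finset.mem_filter.mp hyb).2
    have hBsum : ∑ a, (B a).card ≤ n := by
      rw [← Finset.card_biUnion fun a _ b _ hab => hBdisj a b hab, ← hn]
      exact Finset.card_le_card (Finset.biUnion_subset.mpr fun a _ => Finset.filter_subset _ _)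
    have hBlt : ∀ a, (B a).card < n := fun a => by
      obtain ⟨b, hb⟩ := exists_ne a
      have h1 : (B a).card + (B b).card ≤ ∑ a, (B a).card := by
        rw [← Finset.sum_pair hb.symm (f := fun a => (B a).card)]
        exact Finset.sum_le_sum_of_subset (Finset.subset_univ _)
      have := hempty b
      have := hcard b
      omega
    have hnpos : 0 < n := (Nat.zero_le _).trans_lt (hBlt a₀)
    have hA'pos : ∀ a, (0 : ℝ) < (A' a).card := fun a =>
      Nat.cast_pos.mpr (Nat.pos_of_ne_zero (hempty a))
    have hA'sum : ∑ a, ((A' a).card : ℝ) ≤ n := by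
      exact_mod_cast (Finset.sum_le_sum fun a _ => hcard a).trans hBsum
    have hholder := rpow_le_sum_mul_rpow hr ht β (fun a => ((A' a).card : ℝ)) hβ hA'pos hsum
      (Nat.cast_pos.mpr hnpos) hA'sum
    calc ENNReal.ofReal (C * (n : ℝ) ^ (-(r / t)))
        ≤ ENNReal.ofReal (∑ a, β a * (C * ((A' a).card : ℝ) ^ (-(r / t)))) := by
          refine ENNReal.ofReal_le_ofReal ?_
          calc _ ≤ C * ∑ a, β a * ((A' a).card : ℝ) ^ (-(r / t)) := by gcongr
            _ = _ := by
              rw [Finset.mul_sum]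
              exact Finset.sum_congr rfl fun a _ => by ring
      _ = ∑ a, ENNReal.ofReal (β a) *
            ENNReal.ofReal (C * ((A' a).card : ℝ) ^ (-(r / t))) := by
          rw [ENNReal.ofReal_sum_of_nonneg fun a _ => mul_nonneg (hβ a).le
            (mul_nonneg hC0.le (Real.rpow_nonneg (Nat.cast_nonneg _) _))]
          exact Finset.sum_congr rfl fun a _ => ENNReal.ofReal_mul (hβ a).le
      _ ≤ _ := by
          gcongr with a
          exact ih _ ((hcard a).trans_lt (hBlt a)) (A' a) rfl

end Separated

/-! ### Families of words -/

section Words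

variable {X : Type*} [MetricSpace X] [MeasurableSpace X]

/-- The data that the compositions of the maps of an iterated function system along words of a
fixed length have in common: weights `q`, lower Lipschitz constants `S`, a common upper Lipschitz
constant `κ`, invariance of the attractor `E` and of the measure `μ`, and the open set condition
for `O`. Invariance of `μ` is expressed through integrals of nonnegative functions. -/
structure IsWordFamily (E O : Set X) (μ : Measure X) (κ : ℝ) {ι : Type*} [Fintype ι]
    (g : ι → X → X) (q S : ι → ℝ) : Prop where
  weight_pos : ∀ a, 0 < q a
  lower_pos : ∀ a, 0 < S a
  lower_le_one : ∀ a, S a ≤ 1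
  lower : ∀ a x y, S a * dist x y ≤ dist (g a x) (g a y)
  upper : ∀ a x y, dist (g a x) (g a y) ≤ κ * dist x y
  continuous : ∀ a, Continuous (g a)
  image_subset : ∀ a, g a '' O ⊆ O
  disjoint : ∀ a b, a ≠ b → Disjoint (g a '' O) (g b '' O)
  eq_iUnion : E = ⋃ a, g a '' E
  lintegral_eq : ∀ F : X → ℝ≥0∞, Measurable F →
    ∫⁻ x, F x ∂μ = ∑ a, ENNReal.ofReal (q a) * ∫⁻ x, F (g a x) ∂μ

namespace IsWordFamily

variable {E O : Set X} {μ : Measure X} {κ κ' : ℝ}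

/-- The empty word. -/
theorem unit : IsWordFamily E O μ 1 (fun _ : Unit => id) (fun _ => 1) (fun _ => 1) where
  weight_pos _ := one_pos
  lower_pos _ := one_pos
  lower_le_one _ := le_rfl
  lower _ _ _ := by simp
  upper _ _ _ := by simp
  continuous _ := continuous_id
  image_subset _ := by simp
  disjoint a b h := absurd (Subsingleton.elim a b) h
  eq_iUnion := by simp only [Set.image_id, Set.iUnion_const]
  lintegral_eq F _ := by simp

variable [BorelSpace X]

/-- Concatenation of words. -/
theorem prod {ι ι' : Type*} [Fintype ι] [Fintype ι'] {g : ι → X → X} {q S : ι → ℝ}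
    {g' : ι' → X → X} {q' S' : ι' → ℝ} (hκ : 0 ≤ κ) (h : IsWordFamily E O μ κ g q S)
    (h' : IsWordFamily E O μ κ' g' q' S') :
    IsWordFamily E O μ (κ * κ') (fun a : ι × ι' => g a.1 ∘ g' a.2) (fun a => q a.1 * q' a.2)
      (fun a => S a.1 * S' a.2) where
  weight_pos a := mul_pos (h.weight_pos _) (h'.weight_pos _)
  lower_pos a := mul_pos (h.lower_pos _) (h'.lower_pos _)
  lower_le_one a := mul_le_one₀ (h.lower_le_one _) (h'.lower_pos _).le (h'.lower_le_one _)
  lower a x y := by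
    rw [mul_assoc]
    exact (mul_le_mul_of_nonneg_left (h'.lower _ _ _) (h.lower_pos _).le).trans (h.lower _ _ _)
  upper a x y := by
    rw [mul_assoc]
    exact (h.upper _ _ _).trans (mul_le_mul_of_nonneg_left (h'.upper _ _ _) hκ)
  continuous a := (h.continuous _).comp (h'.continuous _)
  image_subset a := by
    rw [Set.image_comp]
    exact (Set.image_mono (h'.image_subset _)).trans (h.image_subset _)
  disjoint a b hab := by
    rw [Set.image_comp, Set.image_comp]
    by_cases h1 : a.1 = b.1
    · have h2 : a.2 ≠ b.2 := fun h2 => hab (Prod.ext h1 h2)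
      have hinj : Function.Injective (g b.1) := fun x y hxy => by
        have h3 := h.lower b.1 x y
        rw [hxy, dist_self] at h3
        exact dist_le_zero.mp (nonpos_of_mul_nonpos_right h3 (h.lower_pos b.1))
      rw [h1]
      exact (Set.disjoint_image_iff hinj).mpr (h'.disjoint _ _ h2)
    · exact (h.disjoint _ _ h1).mono (Set.image_mono (h'.image_subset _))
        (Set.image_mono (h'.image_subset _))
  eq_iUnion := by
    conv_lhs => rw [h.eq_iUnion]
    rw [Set.iUnion_prod']
    refine Set.iUnion_congr fun a => ?_
    conv_lhs => rw [h'.eq_iUnion]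
    rw [Set.image_iUnion]
    exact Set.iUnion_congr fun b => (Set.image_comp _ _ _).symm
  lintegral_eq F hF := by
    rw [h.lintegral_eq F hF, Fintype.sum_prod_type]
    refine Finset.sum_congr rfl fun a _ => ?_
    rw [h'.lintegral_eq (fun x => F (g a x)) (hF.comp (h.continuous a).measurable),
      Finset.mul_sum]
    refine Finset.sum_congr rfl fun b _ => ?_
    rw [ENNReal.ofReal_mul (h.weight_pos a).le, mul_assoc]
    rfl

/-- The words of length `m`, for which the sum of powers is multiplicative. -/
theorem exists_pow {ι : Type} [Fintype ι] {f : ι → X → X} {p s : ι → ℝ} (hκ : 0 ≤ κ)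
    (h : IsWordFamily E O μ κ f p s) (r θ : ℝ) (m : ℕ) :
    ∃ (ι' : Type) (_ : Fintype ι') (g : ι' → X → X) (q S : ι' → ℝ),
      IsWordFamily E O μ (κ ^ m) g q S ∧ Fintype.card ι' = Fintype.card ι ^ m ∧
      ∑ a, (q a * S a ^ r) ^ θ = (∑ i, (p i * s i ^ r) ^ θ) ^ m := by
  induction m with
  | zero => exact ⟨Unit, inferInstance, _, _, _, by simpa using unit, by simp, by simp⟩
  | succ m ih =>
    obtain ⟨ι', _, g, q, S, hg, hcard, hsum⟩ := ih
    refine ⟨ι × ι', inferInstance, _, _, _, by simpa [pow_succ'] using h.prod hκ hg, ?_, ?_⟩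
    · rw [Fintype.card_prod, hcard, pow_succ']
    · rw [pow_succ', ← hsum, Finset.sum_mul_sum, Fintype.sum_prod_type]
      refine Finset.sum_congr rfl fun a _ => Finset.sum_congr rfl fun b _ => ?_
      have h1 := (h.weight_pos a).le
      have h2 := (h.lower_pos a).le
      have h3 := (hg.weight_pos b).le
      have h4 := (hg.lower_pos b).le
      rw [← Real.mul_rpow (by positivity) (by positivity), Real.mul_rpow h2 h4]
      congr 1
      ring

/-- Some composition maps the attractor into the open set: a long word `a` with
`x ∈ g a '' E` for a point `x ∈ O ∩ E` will do, since `g a '' E` has small diameter. -/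
theorem exists_image_subset {ι : Type} [Fintype ι] {f : ι → X → X} {p s : ι → ℝ} (hκ : 0 ≤ κ)
    (hκ1 : κ < 1) (h : IsWordFamily E O μ κ f p s) (hE : IsCompact E) (hO : IsOpen O)
    (hOE : (O ∩ E).Nonempty) :
    ∃ (m : ℕ) (ι' : Type) (_ : Fintype ι') (g : ι' → X → X) (q S : ι' → ℝ) (a : ι'),
      IsWordFamily E O μ (κ ^ m) g q S ∧ g a '' E ⊆ O := by
  obtain ⟨x, hxO, hxE⟩ := hOE
  obtain ⟨ε, hε, hball⟩ := Metric.isOpen_iff.mp hO x hxO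
  have hlim : Tendsto (fun m : ℕ => κ ^ m * diam E) atTop (nhds 0) := by
    simpa using (tendsto_pow_atTop_nhds_zero_of_lt_one hκ hκ1).mul_const (diam E)
  obtain ⟨m, hm⟩ := (hlim.eventually (gt_mem_nhds hε)).exists
  obtain ⟨ι', _, g, q, S, hg, -, -⟩ := h.exists_pow hκ 1 1 m
  rw [hg.eq_iUnion] at hxE
  obtain ⟨a, y, hyE, rfl⟩ := Set.mem_iUnion.mp hxE
  refine ⟨m, ι', _, g, q, S, a, hg, ?_⟩
  rintro _ ⟨z, hzE, rfl⟩
  refine hball ((hg.upper a z y).trans_lt (lt_of_le_of_lt ?_ hm))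
  gcongr
  exact dist_le_diam_of_mem hE.isBounded hzE hyE

/-- Lower bound for the quantization error of every order below the critical one. The separated
family consists of the long words followed by a fixed word that maps `E` into `O`. -/
theorem exists_le_quantizationError {ι : Type} [Fintype ι] [Nontrivial ι] {f : ι → X → X}
    {p s : ι → ℝ} (hκ : 0 ≤ κ) (hκ1 : κ < 1) (h : IsWordFamily E O μ κ f p s)
    [IsProbabilityMeasure μ] (hμE : μ Eᶜ = 0) (hE : IsCompact E) (hO : IsOpen O)
    (hOE : (O ∩ E).Nonempty) {r t : ℝ} (hr : 0 < r) (ht : 0 < t)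
    (hsum : 1 < ∑ i, (p i * s i ^ r) ^ (t / (r + t))) :
    ∃ C : ℝ, 0 < C ∧ ∀ n : ℕ, 0 < n →
      ENNReal.ofReal (C * (n : ℝ) ^ (-(r / t))) ≤ quantizationError μ n r := by
  obtain ⟨m₀, ι₀, _, g₀, q₀, S₀, a₀, h₀, ha₀⟩ := h.exists_image_subset hκ hκ1 hE hO hOE
  set θ := t / (r + t) with hθ
  set c := (q₀ a₀ * (S₀ a₀ / 2) ^ r) ^ θ with hc_def
  have hq₀ := h₀.weight_pos a₀
  have hS₀ := h₀.lower_pos a₀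
  have hc : 0 < c := by positivity
  obtain ⟨m, hm0, hm⟩ : ∃ m : ℕ, m ≠ 0 ∧ 1 ≤ (∑ i, (p i * s i ^ r) ^ θ) ^ m * c :=
    (((tendsto_pow_atTop_atTop_of_one_lt hsum).atTop_mul_const hc).eventually_ge_atTop
      1).and (eventually_ne_atTop 0) |>.exists.imp fun m hm => ⟨hm.2, hm.1⟩
  obtain ⟨ι', _, g, q, S, hg, hcard, hgsum⟩ := h.exists_pow hκ r θ m
  have : Nontrivial ι' := by
    rw [← Fintype.one_lt_card_iff_nontrivial, hcard]
    exact one_lt_pow₀ Fintype.one_lt_card hm0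
  obtain ⟨δ, C, hC, hbound⟩ := exists_le_truncatedError hE hOE.right μ hμE
    (fun a => g a ∘ g₀ a₀) (fun a => q a * q₀ a₀) (fun a => S a * S₀ a₀)
    (fun a => (hg.continuous a).comp (h₀.continuous a₀))
    (fun a => mul_pos (hg.weight_pos a) hq₀) (fun a => mul_pos (hg.lower_pos a) hS₀)
    (fun a => mul_le_one₀ (hg.lower_le_one a) hS₀.le (h₀.lower_le_one a₀))
    (fun a x y => by
      rw [mul_assoc]
      exact (mul_le_mul_of_nonneg_left (h₀.lower _ _ _) (hg.lower_pos _).le).trans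
        (hg.lower _ _ _))
    (fun a b hab => by
      rw [Set.image_comp, Set.image_comp]
      exact (hg.disjoint a b hab).mono (Set.image_mono ha₀) (Set.image_mono ha₀))
    (fun F hF => by
      rw [hg.lintegral_eq F hF]
      refine Finset.sum_le_sum fun a _ => ?_
      rw [h₀.lintegral_eq (fun x => F (g a x)) (hF.comp (hg.continuous a).measurable),
        ENNReal.ofReal_mul (hg.weight_pos a).le, mul_assoc]
      gcongr 1
      exact Finset.single_le_sum (f := fun b => ENNReal.ofReal (q₀ b) *
        ∫⁻ x, F (g a (g₀ b x)) ∂μ) (fun _ _ => zero_le) (Finset.mem_univ a₀))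
    hr ht (by
      refine hm.trans (le_of_eq ?_)
      rw [← hgsum, Finset.sum_mul]
      refine Finset.sum_congr rfl fun a _ => ?_
      have h1 := (hg.weight_pos a).le
      have h2 := (hg.lower_pos a).le
      rw [hc_def, ← Real.mul_rpow (by positivity) (by positivity), mul_div_assoc,
        Real.mul_rpow h2 (by positivity)]
      congr 1
      ring)
  refine ⟨C, hC, fun n hn => ?_⟩
  unfold quantizationError
  refine le_iInf₂ fun A hA => ?_
  have htrunc : ∫⁻ x, truncatedError δ r A x ∂μ ≤ ∫⁻ x, infEDist x (A : Set X) ^ r ∂μ := by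
    refine lintegral_mono fun x => ?_
    exact ENNReal.rpow_le_rpow (min_le_left _ _) hr.le
  rcases A.card.eq_zero_or_pos with h0 | hpos
  · rw [Finset.card_eq_zero] at h0
    simp [h0, hr]
  · refine le_trans (le_trans (ENNReal.ofReal_le_ofReal ?_) (hbound A)) htrunc
    have hpos' : (0 : ℝ) < A.card := Nat.cast_pos.mpr hpos
    have hA' : (A.card : ℝ) ≤ n := Nat.cast_le.mpr hA
    have : 0 ≤ r / t := by positivity
    gcongr C * ?_
    exact Real.rpow_le_rpow_of_nonpos hpos' hA' (by linarith)

end IsWordFamily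

end Words

/-! ### From error bounds to the quantization dimension -/

section Dimension

variable {X : Type*} [MetricSpace X] [MeasurableSpace X]

/-- A finite `1 / 2`-net of the compact support eventually makes the error smaller than `1`, so
that the denominator in the definition of the dimension is positive. -/
theorem eventually_quantizationError_lt_one {E : Set X} (hE : IsCompact E) (μ : Measure X)
    [IsProbabilityMeasure μ] (hμE : μ Eᶜ = 0) {r : ℝ} (hr : 0 < r) :
    ∀ᶠ n : ℕ in atTop, quantizationError μ n r < 1 := by
  obtain ⟨T, -, hT, hcov⟩ := finite_cover_balls_of_compact hE (e := 1 / 2) (by norm_num)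
  have hae : ∀ᵐ x ∂μ, x ∈ E := by
    rw [ae_iff]
    exact hμE
  filter_upwards [eventually_ge_atTop hT.toFinset.card] with n hn
  have hle : quantizationError μ n r ≤ ENNReal.ofReal (1 / 2) ^ r :=
    calc quantizationError μ n r
        ≤ ∫⁻ x, infEDist x (hT.toFinset : Set X) ^ r ∂μ :=
          iInf₂_le (f := fun (A : Finset X) (_ : A.card ≤ n) =>
            ∫⁻ x, infEDist x (A : Set X) ^ r ∂μ) hT.toFinset hn
      _ ≤ ∫⁻ _, ENNReal.ofReal (1 / 2) ^ r ∂μ := by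
          refine lintegral_mono_ae ?_
          filter_upwards [hae] with x hx
          obtain ⟨y, hy, hxy⟩ := Set.mem_iUnion₂.mp (hcov hx)
          refine ENNReal.rpow_le_rpow ?_ hr.le
          refine (infEDist_le_edist_of_mem (by simpa using hy)).trans ?_
          rw [edist_dist]
          exact ENNReal.ofReal_le_ofReal (mem_ball.mp hxy).le
      _ = ENNReal.ofReal (1 / 2) ^ r := by simp
  refine hle.trans_lt (ENNReal.rpow_lt_one ?_ hr)
  rw [ENNReal.ofReal_lt_one]
  norm_num

/-- A multiplicative constant in the error bounds changes the dimension quotient only by a term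
that vanishes as `n → ∞`. -/
theorem le_lowerQuantizationDim {μ : Measure X} {r k : ℝ} (hr : 0 < r)
    (hlt : ∀ᶠ n : ℕ in atTop, quantizationError μ n r < 1)
    (hbound : ∀ t, 0 < t → t < k → ∃ C : ℝ, 0 < C ∧ ∀ n : ℕ, 0 < n →
      ENNReal.ofReal (C * (n : ℝ) ^ (-(r / t))) ≤ quantizationError μ n r) :
    (k : EReal) ≤ lowerQuantizationDim μ r := by
  have hpos : ∀ᶠ n : ℕ in atTop, 0 < -ENNReal.log (quantizationError μ n r ^ (1 / r)) := by
    filter_upwards [hlt] with n hn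
    rw [EReal.neg_pos, ENNReal.log_lt_zero_iff]
    exact ENNReal.rpow_lt_one hn (by positivity)
  have hlog : ∀ n : ℕ, 0 < n → ENNReal.log (n : ℝ≥0∞) = (Real.log n : ℝ) := fun n hn => by
    rw [← ENNReal.ofReal_natCast, ENNReal.log_ofReal_of_pos (Nat.cast_pos.mpr hn)]
  have hnonneg : 0 ≤ lowerQuantizationDim μ r := by
    refine le_liminf_of_le (by isBoundedDefault) ?_
    filter_upwards [hpos, eventually_gt_atTop 0] with n hn hn0
    refine EReal.div_nonneg ?_ hn.le
    rw [hlog n hn0]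
    exact_mod_cast Real.log_natCast_nonneg n
  refine EReal.ge_of_forall_gt_iff_ge.mp fun t htk => ?_
  rcases le_or_gt t 0 with ht | ht
  · exact le_trans (by exact_mod_cast ht) hnonneg
  have htk' : t < k := by exact_mod_cast htk
  -- An exponent `u` strictly between `t` and `k` leaves room for the multiplicative constant.
  obtain ⟨u, htu, huk⟩ := exists_between htk'
  have hu : 0 < u := ht.trans htu
  obtain ⟨C, hC, hb⟩ := hbound u hu huk
  have hlim : Tendsto (fun n : ℕ => (1 - t / u) * Real.log n) atTop atTop := by
    refine (Real.tendsto_log_atTop.comp tendsto_natCast_atTop_atTop).const_mul_atTop ?_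
    rw [sub_pos, div_lt_one hu]
    exact htu
  refine le_liminf_of_le (by isBoundedDefault) ?_
  filter_upwards [hpos, eventually_gt_atTop 0,
    hlim.eventually_ge_atTop (-(t / r * Real.log C))] with n hn hn0 hnC
  have hn0' : (0 : ℝ) < n := Nat.cast_pos.mpr hn0
  set x := C * (n : ℝ) ^ (-(r / u)) with hx_def
  have hx : 0 < x := by positivity
  have hle : -ENNReal.log (quantizationError μ n r ^ (1 / r)) ≤
      ((-Real.log (x ^ (1 / r)) : ℝ) : EReal) := by
    rw [EReal.coe_neg, EReal.neg_le_neg_iff, ← ENNReal.log_ofReal_of_pos (by positivity),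
      ← ENNReal.ofReal_rpow_of_pos hx]
    exact ENNReal.log_monotone (ENNReal.rpow_le_rpow (hb n hn0) (by positivity))
  rw [EReal.le_div_iff_mul_le hn (hle.trans_lt (EReal.coe_lt_top _)).ne, hlog n hn0]
  calc (t : EReal) * -ENNReal.log (quantizationError μ n r ^ (1 / r))
      ≤ (t : EReal) * ((-Real.log (x ^ (1 / r)) : ℝ) : EReal) :=
        mul_le_mul_of_nonneg_left hle (by exact_mod_cast ht.le)
    _ ≤ (Real.log n : ℝ) := by
        rw [← EReal.coe_mul, EReal.coe_le_coe_iff, Real.log_rpow hx, hx_def,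
          Real.log_mul hC.ne' (by positivity), Real.log_rpow hn0']
        have : t * -(1 / r * (Real.log C + -(r / u) * Real.log n)) =
            -(t / r * Real.log C) + t / u * Real.log n := by field_simp; ring
        rw [this]
        linarith

end Dimension

/-! ### The lower bound -/

/-- The maps of the system form the word family of length one. -/
theorem isWordFamily_of_isInvariantMeasure {X : Type*} [MetricSpace X] [MeasurableSpace X]
    [BorelSpace X] {N : ℕ} {f : Fin N → X → X} {p s : Fin N → ℝ} {κ : ℝ} {E O : Set X}
    {μ : Measure X} (hp : ∀ i, 0 < p i) (hs : ∀ i, 0 < s i) (hs1 : ∀ i, s i ≤ 1)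
    (hlow : ∀ i x y, s i * dist x y ≤ dist (f i x) (f i y)) (hκ : 0 ≤ κ)
    (hup : ∀ i x y, dist (f i x) (f i y) ≤ κ * dist x y) (hE : IsAttractor f E)
    (hsub : ∀ i, f i '' O ⊆ O) (hdisj : ∀ i j, i ≠ j → Disjoint (f i '' O) (f j '' O))
    (hμ : IsInvariantMeasure f p E μ) : IsWordFamily E O μ κ f p s := by
  have hcont : ∀ i, Continuous (f i) := fun i =>
    (LipschitzWith.of_dist_le_mul (K := ⟨κ, hκ⟩) (hup i)).continuous
  refine ⟨hp, hs, hs1, hlow, hup, hcont, hsub, hdisj, hE.eq_iUnion, fun F hF => ?_⟩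
  conv_lhs => rw [hμ.eq_sum]
  rw [lintegral_finsetSum_measure]
  refine Finset.sum_congr rfl fun i _ => ?_
  rw [lintegral_smul_measure, lintegral_map hF (hcont i).measurable, smul_eq_mul]

theorem mainTheorem3 {d N : ℕ}
    (f : Fin N → EuclideanSpace ℝ (Fin d) → EuclideanSpace ℝ (Fin d))
    (p s c : Fin N → ℝ)
    (hp : ∀ i, 0 < p i) (hp_sum : ∑ i, p i = 1)
    (hs : ∀ i, 0 < s i) (hsc : ∀ i, s i ≤ c i) (hc : ∀ i, c i < 1)
    (hf_lower : ∀ i x y, s i * ‖x - y‖ ≤ ‖f i x - f i y‖)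
    (hf_upper : ∀ i x y, ‖f i x - f i y‖ ≤ c i * ‖x - y‖)
    (E : Set (EuclideanSpace ℝ (Fin d))) (hE : IsAttractor f E)
    (hSOSC : StrongOpenSetCondition f E)
    (μ : MeasureTheory.Measure (EuclideanSpace ℝ (Fin d))) (hμ : IsInvariantMeasure f p E μ)
    (r : ℝ) (hr : 0 < r) :
    (∃! k : ℝ, 0 ≤ k ∧ ∑ i, (p i * s i ^ r) ^ (k / (r + k)) = 1) ∧
    ∀ k : ℝ, 0 ≤ k → ∑ i, (p i * s i ^ r) ^ (k / (r + k)) = 1 →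
      (k : EReal) ≤ lowerQuantizationDim μ r := by
  have hN : Nonempty (Fin N) := by
    by_contra h
    rw [not_nonempty_iff] at h
    simp at hp_sum
  have hs1 : ∀ i, s i < 1 := fun i => (hsc i).trans_lt (hc i)
  have hp1 : ∀ i, p i ≤ 1 := fun i => hp_sum ▸
    Finset.single_le_sum (fun j _ => (hp j).le) (Finset.mem_univ i)
  have hsr : ∀ i, s i ^ r < 1 := fun i => Real.rpow_lt_one (hs i).le (hs1 i) hr
  have hb0 : ∀ i, 0 < p i * s i ^ r := fun i => mul_pos (hp i) (Real.rpow_pos_of_pos (hs i) r)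
  have hbp : ∀ i, p i * s i ^ r < p i := fun i => mul_lt_of_lt_one_right (hp i) (hsr i)
  have hb1 : ∀ i, p i * s i ^ r < 1 := fun i => (hbp i).trans_le (hp1 i)
  refine ⟨existsUnique_sum_rpow_eq_one _ hb0 hb1 ?_ hr, fun k hk hk1 => ?_⟩
  · rw [← hp_sum]
    exact Finset.sum_lt_sum_of_nonempty Finset.univ_nonempty fun i _ => hbp i
  have := hμ.isProbabilityMeasure
  refine le_lowerQuantizationDim hr
    (eventually_quantizationError_lt_one hE.isCompact μ hμ.measure_compl hr) fun t ht htk => ?_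
  obtain ⟨O, hO, hOE, hsub, hdisj⟩ := hSOSC
  obtain ⟨i₀, hi₀⟩ := Finite.exists_max c
  have hκ : 0 ≤ c i₀ := (hs i₀).le.trans (hsc i₀)
  have hfam := isWordFamily_of_isInvariantMeasure (κ := c i₀) hp hs (fun i => (hs1 i).le)
    (by simpa only [dist_eq_norm] using hf_lower) hκ
    (fun i x y => by
      rw [dist_eq_norm, dist_eq_norm]
      exact (hf_upper i x y).trans (mul_le_mul_of_nonneg_right (hi₀ i) (norm_nonneg _)))
    hE hsub hdisj hμ
  -- For a single map the equation forces `k = 0`, so `0 < t < k` leaves at least two maps.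
  have : Nontrivial (Fin N) := by
    by_contra hN1
    rw [not_nontrivial_iff_subsingleton] at hN1
    have h1 : (p i₀ * s i₀ ^ r) ^ (k / (r + k)) = 1 := by
      rwa [Fintype.sum_subsingleton _ i₀] at hk1
    exact (Real.rpow_lt_one (hb0 i₀).le (hb1 i₀) (by have := ht.trans htk; positivity)).ne h1
  refine hfam.exists_le_quantizationError hκ (hc i₀) hμ.measure_compl hE.isCompact hO hOE hr ht ?_
  rw [← hk1]
  exact sum_rpow_strictAnti _ hb0 hb1 (div_add_lt_div_add hr ht.le htk)
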